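/- **Duality theorem.** Let $d \ge 1$. Let $BV([0,1]^d)$ be the space of (classes of) Lebesgue integrable functions $u \colon \mathbb{R}^d \to \mathbb{R}$ that vanish almost everywhere outside $[0,1]^d$ and whose variation $$\|Du\|(\mathbb{R}^d) = \sup\left\{ \int_{\mathbb{R}^d} u \,\operatorname{div} v : v \in C^1_c(\mathbb{R}^d;\mathbb{R}^d),\ |v(x)| \le 1 \text{ for all } x \right\}$$ is finite, equipped with the norm $\|u\|_{BV} = \|u\|_{L^1} + \|Du\|(\mathbb{R}^d)$. For $f \in L^d([0,1]^d)$ let $T_f(u) = \int_{[0,1]^d} f u$ for $u \in BV([0,1]^d)$. Then these integrals converge absolutely, $T_f \in BV([0,1]^d)^*$, and there is a constant $C$ such that $\|T_f\| \le C \|f\|_{L^d}$ for all $f \in L^d([0,1]^d)$. Let $SCH([0,1]^d)$ be the closure of $\{T_f : f \in L^d([0,1]^d)\}$ in $BV([0,1]^d)^*$ for the dual norm. Then $BV([0,1]^d)$ and $SCH([0,1]^d)$ are Banach spaces and the canonical map $$\Upsilon \colon BV([0,1]^d) \to SCH([0,1]^d)^*, \qquad \Upsilon(u)(\alpha) = \alpha(u),$$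 is an isomorphism of Banach spaces, that is, a linear bijection that is continuous together with its inverse. In particular, $SCH([0,1]^d)$ is a predual of $BV([0,1]^d)$. -/

import Mathlib

set_option maxSynthPendingDepth 3

open MeasureTheory
open scoped ENNReal

noncomputable section

namespace StrongCharge

/-- The ambient space `ℝ^d` with its Euclidean norm and Lebesgue measure. -/
abbrev E (d : ℕ) : Type := EuclideanSpace ℝ (Fin d)

/-- The closed unit cube `[0,1]^d`. -/
def cube (d : ℕ) : Set (E d) := {x | ∀ i, x i ∈ Set.Icc (0 : ℝ) 1}

/-- The divergence `∑ i, ∂ᵢ vᵢ` of a vector field. -/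
def divergence {d : ℕ} (v : E d → E d) (x : E d) : ℝ :=
  ∑ i, (fderiv ℝ v x (EuclideanSpace.single i 1)) i

/-- Admissible test fields: `C¹`, compactly supported, of pointwise Euclidean norm at most one. -/
structure IsTestField {d : ℕ} (v : E d → E d) : Prop where
  contDiff : ContDiff ℝ 1 v
  hasCompactSupport : HasCompactSupport v
  norm_le_one : ∀ x, ‖v x‖ ≤ 1

/-- The variation `‖Du‖(ℝ^d) = sup {∫ u div v}` of an integrable function `u` on `ℝ^d`, the
supremum being over all admissible test fields. (As `v = 0` is admissible, truncating the
integrals at `0` does not change the supremum.) -/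
def variation {d : ℕ} (u : E d → ℝ) : ℝ≥0∞ :=
  ⨆ (v : E d → E d) (_ : IsTestField v), ENNReal.ofReal (∫ x, u x * divergence v x)

theorem IsTestField.neg {d : ℕ} {v : E d → E d} (hv : IsTestField v) : IsTestField (-v) :=
  ⟨hv.contDiff.neg, hv.hasCompactSupport.neg, fun x => by simpa using hv.norm_le_one x⟩

theorem divergence_neg {d : ℕ} (v : E d → E d) (x : E d) :
    divergence (-v) x = -divergence v x := by
  simp [divergence, fderiv_neg]

theorem IsTestField.integrable_mul {d : ℕ} {v : E d → E d} (hv : IsTestField v) {u : E d → ℝ}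
    (hu : Integrable u) : Integrable (fun x => u x * divergence v x) := by
  have hc : Continuous (divergence v) := by
    have h := hv.contDiff.continuous_fderiv one_ne_zero
    unfold divergence
    fun_prop
  have hs : HasCompactSupport (divergence v) := by
    refine (hv.hasCompactSupport.fderiv (𝕜 := ℝ)).mono' ?_
    intro x hx
    refine subset_tsupport _ ?_
    intro h0
    exact hx (by simp [divergence, h0])
  obtain ⟨C, hC⟩ := hs.exists_bound_of_continuous hc
  exact hu.mul_bdd hc.aestronglyMeasurable (Filter.Eventually.of_forall hC)

theorem variation_congr {d : ℕ} {u w : E d → ℝ} (h : u =ᵐ[volume] w) :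
    variation u = variation w := by
  unfold variation
  refine iSup_congr fun v => iSup_congr fun _ => ?_
  congr 1
  exact integral_congr_ae (h.mono fun x hx => by simp [hx])

theorem variation_zero {d : ℕ} : variation (0 : E d → ℝ) = 0 := by
  simp [variation]

theorem variation_add_le {d : ℕ} {u w : E d → ℝ} (hu : Integrable u) (hw : Integrable w) :
    variation (u + w) ≤ variation u + variation w := by
  refine iSup₂_le fun v hv => ?_
  have h : ∫ x, (u + w) x * divergence v x
      = (∫ x, u x * divergence v x) + ∫ x, w x * divergence v x := by
    rw [← integral_add (hv.integrable_mul hu) (hv.integrable_mul hw)]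
    simp [add_mul]
  rw [h]
  exact ENNReal.ofReal_add_le.trans
    (add_le_add (le_iSup₂_of_le v hv le_rfl) (le_iSup₂_of_le v hv le_rfl))

theorem variation_smul_le {d : ℕ} (c : ℝ) (u : E d → ℝ) :
    variation (c • u) ≤ ENNReal.ofReal |c| * variation u := by
  refine iSup₂_le fun v hv => ?_
  have h : ∫ x, (c • u) x * divergence v x = c * ∫ x, u x * divergence v x := by
    rw [← integral_const_mul]
    simp [mul_assoc]
  rw [h]
  rcases le_total 0 c with hc | hc
  · rw [ENNReal.ofReal_mul hc, abs_of_nonneg hc]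
    gcongr
    exact le_iSup₂_of_le v hv le_rfl
  · have h2 : c * ∫ x, u x * divergence v x = (-c) * ∫ x, u x * divergence (-v) x := by
      simp [divergence_neg, integral_neg]
    rw [h2, ENNReal.ofReal_mul (by linarith), abs_of_nonpos hc]
    gcongr
    exact le_iSup₂_of_le (-v) hv.neg le_rfl

/-- The underlying vector space of `BV([0,1]^d)`: classes of integrable functions on `ℝ^d` that
vanish almost everywhere outside `[0,1]^d` and have finite variation over `ℝ^d`. -/
def bvSubmodule (d : ℕ) : Submodule ℝ (Lp ℝ 1 (volume : Measure (E d))) where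
  carrier := {u | (∀ᵐ x, x ∉ cube d → u x = 0) ∧ variation u < ∞}
  zero_mem' := by
    refine ⟨?_, ?_⟩
    · filter_upwards [Lp.coeFn_zero ℝ 1 (volume : Measure (E d))] with x hx _
      rw [hx]; rfl
    · rw [variation_congr (Lp.coeFn_zero ℝ 1 (volume : Measure (E d))), variation_zero]
      exact ENNReal.zero_lt_top
  add_mem' := by
    rintro u w ⟨hu, hu'⟩ ⟨hw, hw'⟩
    refine ⟨?_, ?_⟩
    · filter_upwards [Lp.coeFn_add u w, hu, hw] with x hx h1 h2 hxc
      rw [hx, Pi.add_apply, h1 hxc, h2 hxc, add_zero]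
    · rw [variation_congr (Lp.coeFn_add u w)]
      exact (variation_add_le (L1.integrable_coeFn u) (L1.integrable_coeFn w)).trans_lt
        (ENNReal.add_lt_top.2 ⟨hu', hw'⟩)
  smul_mem' := by
    rintro c u ⟨hu, hu'⟩
    refine ⟨?_, ?_⟩
    · filter_upwards [Lp.coeFn_smul c u, hu] with x hx h1 hxc
      rw [hx, Pi.smul_apply, h1 hxc, smul_zero]
    · rw [variation_congr (Lp.coeFn_smul c u)]
      exact (variation_smul_le c u).trans_lt (ENNReal.mul_lt_top ENNReal.ofReal_lt_top hu')

/-- The space `BV([0,1]^d)`; its norm is defined below (it is not the one inherited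
from `L¹`). -/
def BV (d : ℕ) : Type := bvSubmodule d

namespace BV

variable {d : ℕ}

instance : AddCommGroup (BV d) := inferInstanceAs (AddCommGroup (bvSubmodule d))

instance : Module ℝ (BV d) := inferInstanceAs (Module ℝ (bvSubmodule d))

/-- The inclusion of `BV([0,1]^d)` in `L¹(ℝ^d)`. -/
def toL1 : BV d →ₗ[ℝ] Lp ℝ 1 (volume : Measure (E d)) := (bvSubmodule d).subtype

instance : CoeFun (BV d) (fun _ => E d → ℝ) := ⟨fun u => (toL1 u : E d → ℝ)⟩

theorem variation_lt_top (u : BV d) : variation (u : E d → ℝ) < ∞ := u.2.2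

/-- `u ↦ ‖Du‖(ℝ^d)` as a seminorm on `BV([0,1]^d)`. -/
def variationSeminorm (d : ℕ) : Seminorm ℝ (BV d) :=
  Seminorm.ofSMulLE (fun u => (variation (u : E d → ℝ)).toReal)
    (by
      have h : variation ((0 : BV d) : E d → ℝ) = 0 := by
        rw [map_zero, variation_congr (Lp.coeFn_zero ℝ 1 (volume : Measure (E d))), variation_zero]
      simp only [h, ENNReal.toReal_zero])
    (fun u w => by
      rw [← ENNReal.toReal_add u.variation_lt_top.ne w.variation_lt_top.ne]
      refine ENNReal.toReal_mono
        (ENNReal.add_ne_top.2 ⟨u.variation_lt_top.ne, w.variation_lt_top.ne⟩) ?_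
      rw [map_add, variation_congr (Lp.coeFn_add _ _)]
      exact variation_add_le (L1.integrable_coeFn _) (L1.integrable_coeFn _))
    (fun c u => by
      have h : variation ((c • u : BV d) : E d → ℝ) ≤ ENNReal.ofReal |c| * variation u := by
        rw [map_smul, variation_congr (Lp.coeFn_smul _ _)]
        exact variation_smul_le c _
      have h2 := ENNReal.toReal_mono
        (ENNReal.mul_ne_top ENNReal.ofReal_ne_top u.variation_lt_top.ne) h
      rwa [ENNReal.toReal_mul, ENNReal.toReal_ofReal (abs_nonneg c)] at h2)

/-- The norm `‖u‖_BV = ‖u‖₁ + ‖Du‖(ℝ^d)`. -/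
instance : Norm (BV d) := ⟨fun u => ‖toL1 u‖ + (variation (u : E d → ℝ)).toReal⟩

theorem norm_def (u : BV d) : ‖u‖ = ‖toL1 u‖ + (variation (u : E d → ℝ)).toReal := rfl

theorem normCore (d : ℕ) : NormedSpace.Core ℝ (BV d) where
  norm_nonneg u := by rw [norm_def]; positivity
  norm_smul c u := by
    have h := map_smul_eq_mul (variationSeminorm d) c u
    change (variation ((c • u : BV d) : E d → ℝ)).toReal = ‖c‖ * (variation (u : E d → ℝ)).toReal
      at h
    rw [norm_def, norm_def, h, map_smul, norm_smul, mul_add]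
  norm_triangle u w := by
    have h := map_add_le_add (variationSeminorm d) u w
    change (variation ((u + w : BV d) : E d → ℝ)).toReal ≤
      (variation (u : E d → ℝ)).toReal + (variation (w : E d → ℝ)).toReal at h
    have h2 : ‖toL1 (u + w)‖ ≤ ‖toL1 u‖ + ‖toL1 w‖ := by
      rw [map_add]; exact norm_add_le _ _
    rw [norm_def, norm_def, norm_def]
    linarith
  norm_eq_zero_iff u := by
    constructor
    · intro h
      rw [norm_def] at h
      have h1 : ‖toL1 u‖ = 0 :=
        ((add_eq_zero_iff_of_nonneg (norm_nonneg _) ENNReal.toReal_nonneg).1 h).1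
      exact Subtype.ext (norm_eq_zero.1 h1)
    · rintro rfl
      have h := map_zero (variationSeminorm d)
      change (variation ((0 : BV d) : E d → ℝ)).toReal = 0 at h
      rw [norm_def, h, map_zero, norm_zero, add_zero]

instance : NormedAddCommGroup (BV d) := NormedAddCommGroup.ofCore (normCore d)

instance : NormedSpace ℝ (BV d) := NormedSpace.ofCore (normCore d)

end BV

/-- The space `L^d([0,1]^d)`. -/
abbrev Ld (d : ℕ) : Type := Lp ℝ (d : ℝ≥0∞) (volume.restrict (cube d))

/-- `α = T_f`, that is, `α(u) = ∫_{[0,1]^d} f u` (an absolutely convergent integral) for all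
`u ∈ BV([0,1]^d)`. -/
def Represents {d : ℕ} (f : Ld d) (α : StrongDual ℝ (BV d)) : Prop :=
  ∀ u : BV d, IntegrableOn (fun x => f x * u x) (cube d) ∧ α u = ∫ x in cube d, f x * u x

/-- The set of all functionals `T_f`, `f ∈ L^d([0,1]^d)`, as a linear subspace
of `BV([0,1]^d)^*`. -/
def rangeT (d : ℕ) : Submodule ℝ (StrongDual ℝ (BV d)) where
  carrier := {α | ∃ f : Ld d, Represents f α}
  zero_mem' := by
    refine ⟨0, fun u => ?_⟩
    have h : (fun x => (0 : Ld d) x * u x) =ᵐ[volume.restrict (cube d)] fun _ => 0 := by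
      filter_upwards [Lp.coeFn_zero ℝ (d : ℝ≥0∞) (volume.restrict (cube d))] with x hx
      rw [hx, Pi.zero_apply, zero_mul]
    exact ⟨(integrable_zero _ _ _).congr h.symm, by rw [integral_congr_ae h]; simp⟩
  add_mem' := by
    rintro α β ⟨f, hf⟩ ⟨g, hg⟩
    refine ⟨f + g, fun u => ?_⟩
    have h : (fun x => (f + g) x * u x) =ᵐ[volume.restrict (cube d)]
        fun x => f x * u x + g x * u x := by
      filter_upwards [Lp.coeFn_add f g] with x hx
      rw [hx, Pi.add_apply, add_mul]
    refine ⟨((hf u).1.add (hg u).1).congr h.symm, ?_⟩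
    rw [integral_congr_ae h, integral_add (hf u).1 (hg u).1, ← (hf u).2, ← (hg u).2]
    rfl
  smul_mem' := by
    rintro c α ⟨f, hf⟩
    refine ⟨c • f, fun u => ?_⟩
    have h : (fun x => (c • f) x * u x) =ᵐ[volume.restrict (cube d)]
        fun x => c * (f x * u x) := by
      filter_upwards [Lp.coeFn_smul c f] with x hx
      rw [hx, Pi.smul_apply, smul_eq_mul, mul_assoc]
    refine ⟨((hf u).1.const_mul c).congr h.symm, ?_⟩
    rw [integral_congr_ae h, integral_const_mul, ← (hf u).2]
    rfl

/-- `SCH([0,1]^d)`, the norm closure of `{T_f : f ∈ L^d([0,1]^d)}` in `BV([0,1]^d)^*`. -/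
def SCH (d : ℕ) : Submodule ℝ (StrongDual ℝ (BV d)) := (rangeT d).topologicalClosure

end StrongCharge

end

open MeasureTheory
open scoped ENNReal

noncomputable section

namespace StrongCharge

open Filter Topology
open scoped NNReal Convolution

variable {d : ℕ}

/-! The embedding of `BV` in the Lebesgue space of exponent conjugate to `d`
(Gagliardo–Nirenberg–Sobolev, extended from smooth functions by mollification) and Hölder's
inequality make `T_f` continuous.

Both halves of the `BV` norm are recovered by testing against elements of the unit ball of `SCH`:
the variation from `T_f` with `f = div v`, the `L¹` norm from `T_f` with `f = sign u`. Hence `‖u‖ ≤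
2 ‖Υ u‖` (`norm_le_two_mul_norm_canonicalMap`).

For surjectivity, a functional `L` on `SCH` is pulled back to `L^d` along `f ↦ T_f`, where
Radon–Nikodym gives a density `g ∈ L¹`. Since `‖T_{div v}‖ ≤ 1`, the extension of `g` by zero has
variation at most `‖L‖`, so it lies in `BV`; density of simple functions in `L^d` and of the `T_f`
in `SCH` identifies its image with `L`. Completeness of `BV` is then inherited from the dual. -/

/-! ### Test fields, integration by parts and mollification -/

theorem continuous_divergence {v : E d → E d} (hv : ContDiff ℝ 1 v) :
    Continuous (divergence v) := by
  have h := hv.continuous_fderiv one_ne_zero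
  unfold divergence
  fun_prop

theorem IsTestField.exists_norm_divergence_le {v : E d → E d} (hv : IsTestField v) :
    ∃ C, ∀ x, ‖divergence v x‖ ≤ C := by
  refine HasCompactSupport.exists_bound_of_continuous ?_ (continuous_divergence hv.contDiff)
  refine (hv.hasCompactSupport.fderiv (𝕜 := ℝ)).mono' fun x hx => subset_tsupport _ fun h0 => ?_
  exact hx (by simp [divergence, h0])

theorem divergence_comp_add_right (v : E d → E d) (y x : E d) :
    divergence (fun z => v (z + y)) x = divergence v (x + y) := by
  simp [divergence, fderiv_comp_add_right]

theorem IsTestField.comp_add_right {v : E d → E d} (hv : IsTestField v) (y : E d) :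
    IsTestField fun z => v (z + y) where
  contDiff := hv.contDiff.comp (contDiff_id.add contDiff_const)
  hasCompactSupport := hv.hasCompactSupport.comp_homeomorph (Homeomorph.addRight y)
  norm_le_one _ := hv.norm_le_one _

theorem ofReal_integral_le_variation {v : E d → E d} (hv : IsTestField v) (u : E d → ℝ) :
    ENNReal.ofReal (∫ x, u x * divergence v x) ≤ variation u :=
  le_iSup₂_of_le v hv le_rfl

theorem integral_le_toReal_variation {v : E d → E d} (hv : IsTestField v) {u : E d → ℝ}
    (hu : variation u ≠ ∞) : ∫ x, u x * divergence v x ≤ (variation u).toReal :=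
  (ENNReal.ofReal_le_iff_le_toReal hu).1 (ofReal_integral_le_variation hv u)

/-- Integration by parts of a `C¹` function with compact support against a `C¹` vector field. -/
theorem integral_mul_divergence {w : E d → ℝ} (hw : ContDiff ℝ 1 w) (hs : HasCompactSupport w)
    {v : E d → E d} (hv : ContDiff ℝ 1 v) :
    ∫ x, w x * divergence v x = -∫ x, fderiv ℝ w x (v x) := by
  have hw' := hw.continuous_fderiv one_ne_zero
  have hv' := hv.continuous_fderiv one_ne_zero
  have hvc := hv.continuous
  have hwc := hw.continuous
  have hs' := hs.fderiv (𝕜 := ℝ)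
  have e1 (x : E d) (i : Fin d) : fderiv ℝ (fun z => v z i) x (EuclideanSpace.single i 1)
      = fderiv ℝ v x (EuclideanSpace.single i 1) i := by
    have h1 := (hv.differentiable one_ne_zero x).hasFDerivAt
    have h2 := ((EuclideanSpace.proj (𝕜 := ℝ) i : E d →L[ℝ] ℝ).hasFDerivAt
      (x := v x)).comp x h1
    have h3 := h2.fderiv
    change fderiv ℝ (fun z => v z i) x = _ at h3
    rw [h3]; rfl
  have e2 (x : E d) : fderiv ℝ w x (v x)
      = ∑ i, fderiv ℝ w x (EuclideanSpace.single i 1) * v x i := by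
    conv_lhs => rw [← (EuclideanSpace.basisFun (Fin d) ℝ).sum_repr (v x)]
    simp [mul_comm]
  have i1 (i : Fin d) : Integrable fun x => w x * fderiv ℝ v x (EuclideanSpace.single i 1) i :=
    Continuous.integrable_of_hasCompactSupport (by fun_prop) hs.mul_right
  have i2 (i : Fin d) : Integrable fun x => fderiv ℝ w x (EuclideanSpace.single i 1) * v x i := by
    refine Continuous.integrable_of_hasCompactSupport (by fun_prop)
      (HasCompactSupport.mul_right ?_)
    exact hs'.comp_left (g := fun L : E d →L[ℝ] ℝ => L (EuclideanSpace.single i 1)) (by simp)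
  have i3 (i : Fin d) : Integrable fun x => w x * v x i :=
    Continuous.integrable_of_hasCompactSupport (by fun_prop) hs.mul_right
  simp_rw [e2, divergence, Finset.mul_sum]
  rw [integral_finsetSum _ fun i _ => i1 i, integral_finsetSum _ fun i _ => i2 i,
    ← Finset.sum_neg_distrib]
  refine Finset.sum_congr rfl fun i _ => ?_
  have hd : Differentiable ℝ fun z => v z i :=
    ((EuclideanSpace.proj (𝕜 := ℝ) i : E d →L[ℝ] ℝ).differentiable).comp
      (hv.differentiable one_ne_zero)
  simp_rw [← e1]
  refine integral_mul_fderiv_eq_neg_fderiv_mul_of_integrable (i2 i) ?_ (i3 i)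
    (fun x _ => hw.differentiable one_ne_zero x) fun x _ => hd x
  simpa only [e1] using i1 i

/-- Riesz representation turns the derivative into a vector field from which test fields can be
built; two derivatives of `w` make it `C¹`, as test fields must be. -/
theorem exists_gradient {w : E d → ℝ} (hw : ContDiff ℝ 2 w) (hs : HasCompactSupport w) :
    ∃ G : E d → E d, ContDiff ℝ 1 G ∧ HasCompactSupport G ∧ (∀ x, ‖G x‖ = ‖fderiv ℝ w x‖) ∧
      ∀ x, fderiv ℝ w x (G x) = ‖G x‖ ^ 2 := by
  refine ⟨fun x => (InnerProductSpace.toDual ℝ (E d)).symm (fderiv ℝ w x),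
    (InnerProductSpace.toDual ℝ (E d)).symm.contDiff.comp (hw.fderiv_right (m := 1) (by norm_num)),
    (hs.fderiv (𝕜 := ℝ)).comp_left (map_zero _), fun x => LinearIsometryEquiv.norm_map _ _,
    fun x => ?_⟩
  rw [← real_inner_self_eq_norm_sq, ← InnerProductSpace.toDual_symm_apply]

/-- For a `C²` function with compact support, `∫ ‖Dw‖` is bounded by the variation. -/
theorem lintegral_enorm_fderiv_le_variation {w : E d → ℝ} (hw : ContDiff ℝ 2 w)
    (hs : HasCompactSupport w) : ∫⁻ x, ‖fderiv ℝ w x‖ₑ ≤ variation w := by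
  obtain ⟨G, hG, hGs, hGn, hGw⟩ := exists_gradient hw hs
  -- The optimal field `-∇w / |∇w|` is singular at critical points. Dividing by `√(|∇w|² + ε)`
  -- instead keeps it `C¹` and of norm at most one; Fatou's lemma along `ε = 1 / (n + 1)` recovers
  -- `∫ |∇w|`.
  let q : ℝ → E d → ℝ := fun ε x => (√(‖G x‖ ^ 2 + ε))⁻¹
  have key (ε : ℝ) (hε : 0 < ε) :
      ∫⁻ x, ENNReal.ofReal (q ε x * ‖G x‖ ^ 2) ≤ variation w := by
    have hpos (x : E d) : 0 < ‖G x‖ ^ 2 + ε := by positivity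
    have hq : ContDiff ℝ 1 (q ε) := by
      have h1 : ContDiff ℝ 1 fun x => ‖G x‖ ^ 2 + ε := (hG.norm_sq ℝ).add contDiff_const
      have h2 := h1.sqrt fun x => (hpos x).ne'
      exact h2.inv fun x => (Real.sqrt_pos.2 (hpos x)).ne'
    have hv : IsTestField fun x => -(q ε x • G x) := by
      refine ⟨(ContDiff.smul (f := q ε) (g := G) hq hG).neg,
        (HasCompactSupport.smul_left (f := q ε) hGs).neg, fun x => ?_⟩
      have h0 : 0 < √(‖G x‖ ^ 2 + ε) := Real.sqrt_pos.2 (hpos x)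
      rw [norm_neg, norm_smul, Real.norm_of_nonneg (inv_nonneg.2 h0.le), inv_mul_le_one₀ h0]
      exact Real.le_sqrt_of_sq_le (by linarith)
    refine le_trans (le_of_eq ?_) (ofReal_integral_le_variation hv w)
    rw [integral_mul_divergence (hw.of_le one_le_two) hs hv.contDiff]
    simp only [map_neg, map_smul, hGw, smul_eq_mul, integral_neg, neg_neg]
    rw [ofReal_integral_eq_lintegral_ofReal]
    · refine Continuous.integrable_of_hasCompactSupport
        (hq.continuous.mul (hG.continuous.norm.pow 2)) (HasCompactSupport.mul_left ?_)
      exact hGs.comp_left (g := fun y => ‖y‖ ^ 2) (by simp)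
    · exact Eventually.of_forall fun x => by positivity
  have hlim (x : E d) : Tendsto (fun n : ℕ => ENNReal.ofReal (q (1 / ((n : ℝ) + 1)) x * ‖G x‖ ^ 2))
      atTop (𝓝 ‖fderiv ℝ w x‖ₑ) := by
    rw [← ofReal_norm, ← hGn]
    refine (ENNReal.continuous_ofReal.tendsto _).comp ?_
    rcases eq_or_ne (G x) 0 with h0 | h0
    · simp [h0]
    have h1 : Tendsto (fun n : ℕ => √(‖G x‖ ^ 2 + 1 / ((n : ℝ) + 1))) atTop (𝓝 ‖G x‖) := by
      have := (tendsto_const_nhds (x := ‖G x‖ ^ 2)).add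
        (tendsto_one_div_add_atTop_nhds_zero_nat (𝕜 := ℝ))
      simpa using this.sqrt
    have h2 := (h1.inv₀ (norm_ne_zero_iff.2 h0)).mul_const (‖G x‖ ^ 2)
    convert! h2 using 2
    have := norm_ne_zero_iff.2 h0
    field_simp
  have hGc := hG.continuous
  calc ∫⁻ x, ‖fderiv ℝ w x‖ₑ
      = ∫⁻ x, liminf (fun n : ℕ => ENNReal.ofReal (q (1 / ((n : ℝ) + 1)) x * ‖G x‖ ^ 2)) atTop :=
        lintegral_congr fun x => (hlim x).liminf_eq.symm
    _ ≤ liminf (fun n : ℕ => ∫⁻ x, ENNReal.ofReal (q (1 / ((n : ℝ) + 1)) x * ‖G x‖ ^ 2)) atTop :=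
        lintegral_liminf_le fun n => by
          simp only [q]
          fun_prop
    _ ≤ variation w :=
        liminf_le_of_le ⟨0, Eventually.of_forall fun _ => zero_le⟩ fun b hb => by
          obtain ⟨n, hn⟩ := hb.exists
          exact hn.trans (key _ (by positivity))

/-- Mollification does not increase the variation. -/
theorem variation_normed_convolution_le (φ : ContDiffBump (0 : E d)) {u : E d → ℝ}
    (hu : Integrable u) :
    variation (φ.normed volume ⋆[ContinuousLinearMap.lsmul ℝ ℝ, volume] u) ≤ variation u := by
  rcases eq_or_ne (variation u) ∞ with h | hfin
  · simp [h]
  refine iSup₂_le fun v hv => ENNReal.ofReal_le_of_le_toReal ?_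
  obtain ⟨C, hC⟩ := hv.exists_norm_divergence_le
  have hφ : Integrable (φ.normed volume : E d → ℝ) := φ.integrable_normed
  have hint : Integrable (fun p : E d × E d => φ.normed volume p.2 * u (p.1 - p.2) *
      divergence v p.1) (volume.prod volume) := by
    have := Integrable.convolution_integrand (ContinuousLinearMap.lsmul ℝ ℝ) hφ hu
    refine this.mul_bdd (c := C) ?_ (Eventually.of_forall fun p => hC _)
    exact ((continuous_divergence hv.contDiff).comp continuous_fst).aestronglyMeasurable
  -- By Fubini, the integral is an average, with the probability density `φ.normed`, of integrals of
  -- `u` against translates of `v`, which are again test fields.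
  calc ∫ x, (φ.normed volume ⋆[ContinuousLinearMap.lsmul ℝ ℝ, volume] u) x * divergence v x
      = ∫ x, ∫ y, φ.normed volume y * u (x - y) * divergence v x := by
        refine integral_congr_ae (Eventually.of_forall fun x => ?_)
        simp only [convolution, ContinuousLinearMap.lsmul_apply, smul_eq_mul]
        rw [integral_mul_const]
    _ = ∫ y, ∫ x, φ.normed volume y * u (x - y) * divergence v x := integral_integral_swap hint
    _ ≤ ∫ y, φ.normed volume y * (variation u).toReal := by
        refine integral_mono hint.integral_prod_right (hφ.mul_const _) fun y => ?_
        simp only [mul_assoc]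
        rw [integral_const_mul]
        refine mul_le_mul_of_nonneg_left ?_ (φ.nonneg_normed _)
        refine le_trans (le_of_eq ?_)
          (integral_le_toReal_variation (hv.comp_add_right y) hfin)
        rw [← integral_add_right_eq_self _ y]
        simp [divergence_comp_add_right]
    _ = (variation u).toReal := by
        rw [integral_mul_const, φ.integral_normed, one_mul]

/-! ### The Gagliardo–Nirenberg–Sobolev inequality -/

/-- The endpoint `d = 1`, where the conjugate exponent is `∞`: after an isometric identification of
`E 1` with `ℝ`, the value `w t` is controlled by the integral of `|w'|` over `(-∞, t]`. -/
theorem eLpNorm_top_le_lintegral_enorm_fderiv {w : E 1 → ℝ} (hw : ContDiff ℝ 1 w)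
    (hs : HasCompactSupport w) : eLpNorm w ∞ volume ≤ ∫⁻ x, ‖fderiv ℝ w x‖ₑ := by
  let γ : ℝ ≃ₗᵢ[ℝ] E 1 := (LinearIsometry.toSpanSingleton ℝ (E 1)
    (v := EuclideanSpace.single 0 1) (by simp)).toLinearIsometryEquiv (by simp)
  have hγ : ContDiff ℝ 1 γ := γ.contDiff
  rw [eLpNorm_exponent_top]
  refine eLpNormEssSup_le_of_ae_enorm_bound (Eventually.of_forall fun x => ?_)
  obtain ⟨t, rfl⟩ := γ.surjective x
  calc ‖w (γ t)‖ₑ ≤ ∫⁻ s in Set.Iic t, ‖deriv (w ∘ γ) s‖ₑ :=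
        HasCompactSupport.enorm_le_lintegral_Ici_deriv (hw.comp hγ)
          (hs.comp_homeomorph γ.toHomeomorph) t
    _ ≤ ∫⁻ s, ‖deriv (w ∘ γ) s‖ₑ := setLIntegral_le_lintegral _ _
    _ ≤ ∫⁻ s, ‖fderiv ℝ w (γ s)‖ₑ := by
        refine lintegral_mono fun s => ?_
        have h1 : HasDerivAt γ (γ 1) s := by
          simpa using (γ : ℝ →L[ℝ] E 1).hasFDerivAt.hasDerivAt (x := s)
        have h2 := (hw.differentiable one_ne_zero (γ s)).hasFDerivAt.comp_hasDerivAt s h1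
        rw [h2.deriv]
        refine (ContinuousLinearMap.le_opENorm _ _).trans ?_
        simp [enorm_eq_nnnorm]
    _ = ∫⁻ x, ‖fderiv ℝ w x‖ₑ :=
        γ.measurePreserving.lintegral_comp_emb γ.toHomeomorph.measurableEmbedding
          (fun x => ‖fderiv ℝ w x‖ₑ)

/-- The conjugate exponent of `d` together with the Gagliardo–Nirenberg–Sobolev inequality for
`C¹` functions of compact support, including the case `d = 1`. -/
theorem exists_eLpNorm_le_lintegral_enorm_fderiv (hd : 1 ≤ d) :
    ∃ (p : ℝ≥0∞) (C : ℝ≥0), ENNReal.HolderConjugate d p ∧ ∀ w : E d → ℝ, ContDiff ℝ 1 w →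
      HasCompactSupport w → eLpNorm w p volume ≤ C * ∫⁻ x, ‖fderiv ℝ w x‖ₑ := by
  rcases hd.eq_or_lt with rfl | hd
  · refine ⟨∞, 1, by simpa using ENNReal.HolderConjugate.instOneInfty, fun w hw hs => ?_⟩
    simpa using eLpNorm_top_le_lintegral_enorm_fderiv hw hs
  · have hp : NNReal.HolderConjugate (d : ℝ≥0) (NNReal.conjExponent d) :=
      .conjExponent (by exact_mod_cast hd)
    refine ⟨NNReal.conjExponent d, eLpNormLESNormFDerivOneConst (volume : Measure (E d))
      (NNReal.conjExponent d), ?_, fun w hw hs => ?_⟩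
    · simpa using hp.coe_ennreal
    · rw [← eLpNorm_one_eq_lintegral_enorm]
      exact eLpNorm_le_eLpNorm_fderiv_one volume hw hs (by simpa using hp)

/-- The Gagliardo–Nirenberg–Sobolev inequality for integrable functions of compact support and
bounded variation. -/
theorem exists_eLpNorm_le_variation (hd : 1 ≤ d) :
    ∃ (p : ℝ≥0∞) (C : ℝ≥0), ENNReal.HolderConjugate d p ∧ ∀ u : E d → ℝ, Integrable u →
      HasCompactSupport u → eLpNorm u p volume ≤ C * variation u := by
  obtain ⟨p, C, hp, h⟩ := exists_eLpNorm_le_lintegral_enorm_fderiv hd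
  refine ⟨p, C, hp, fun u hu hs => ?_⟩
  -- The radii shrink to zero with fixed ratio `2`; a bounded ratio is what yields almost everywhere
  -- convergence of the mollifications of a merely locally integrable function.
  let φ (n : ℕ) : ContDiffBump (0 : E d) :=
    ⟨1 / ((n : ℝ) + 1), 2 * (1 / ((n : ℝ) + 1)), by positivity,
      by linarith [show (0 : ℝ) < 1 / ((n : ℝ) + 1) by positivity]⟩
  have hlim := ContDiffBump.ae_convolution_tendsto_right_of_locallyIntegrable (μ := volume)
    (φ := φ) (l := atTop) (K := 2)
    (by simpa [φ] using (tendsto_one_div_add_atTop_nhds_zero_nat (𝕜 := ℝ)).const_mul 2)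
    (Eventually.of_forall fun n => le_rfl) hu.locallyIntegrable
  have hsmooth (n : ℕ) : ContDiff ℝ 2
      ((φ n).normed volume ⋆[ContinuousLinearMap.lsmul ℝ ℝ, volume] u) :=
    ((φ n).hasCompactSupport_normed (μ := volume)).contDiff_convolution_left (n := 2) _
      (φ n).contDiff_normed hu.locallyIntegrable
  -- Lower semicontinuity of the norm under almost everywhere convergence also covers `p = ∞`, so
  -- both cases of the exponent are treated at once.
  refine (Lp.eLpNorm_lim_le_liminf_eLpNorm
    (fun n => (hsmooth n).continuous.aestronglyMeasurable) u hlim).trans ?_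
  refine liminf_le_of_le ⟨0, Eventually.of_forall fun _ => zero_le⟩ fun b hb => ?_
  obtain ⟨n, hn⟩ := hb.exists
  have hc := ((φ n).hasCompactSupport_normed (μ := volume)).convolution (μ := volume)
    (ContinuousLinearMap.lsmul ℝ ℝ) hs
  refine hn.trans ((h _ ((hsmooth n).of_le (by norm_num)) hc).trans ?_)
  gcongr
  exact (lintegral_enorm_fderiv_le_variation (hsmooth n) hc).trans
    (variation_normed_convolution_le _ hu)

/-! ### Functionals on `Lᵖ` of a finite measure -/

section LpDual

variable {α : Type*} {m : MeasurableSpace α} {μ : Measure α} [IsFiniteMeasure μ] {p : ℝ≥0∞}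

theorem indicatorConstLp_finset_biUnion {s : ℕ → Set α} (hs : ∀ i, MeasurableSet (s i))
    (hd : Pairwise (Function.onFun Disjoint s)) (t : Finset ℕ) :
    indicatorConstLp p (t.measurableSet_biUnion fun i _ => hs i) (measure_ne_top μ _) (1 : ℝ) =
      ∑ i ∈ t, indicatorConstLp p (hs i) (measure_ne_top μ _) (1 : ℝ) := by
  induction t using Finset.induction_on with
  | empty => simp
  | insert a t ha ih =>
    rw [Finset.sum_insert ha, ← ih]
    have hdis : Disjoint (s a) (⋃ i ∈ t, s i) := by
      rw [Set.disjoint_iUnion₂_right]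
      exact fun i hi => hd (by rintro rfl; exact ha hi)
    rw [← indicatorConstLp_disjoint_union _ _ _ _ hdis]
    congr 1
    simp

variable [Fact (1 ≤ p)]

/-- For `p < ∞`, indicators converge in `Lᵖ` once the symmetric differences have measure tending to
zero. This is the countable additivity of `s ↦ ℓ (1_s)`. -/
theorem hasSum_indicatorConstLp (hp : p ≠ ∞) {s : ℕ → Set α}
    (hs : ∀ i, MeasurableSet (s i)) (hd : Pairwise (Function.onFun Disjoint s)) :
    HasSum (fun i => indicatorConstLp p (hs i) (measure_ne_top μ _) (1 : ℝ))
      (indicatorConstLp p (MeasurableSet.iUnion hs) (measure_ne_top μ _) (1 : ℝ)) := by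
  have : Tendsto (fun t : Finset ℕ => indicatorConstLp p
      (t.measurableSet_biUnion fun i _ => hs i) (measure_ne_top μ _) (1 : ℝ)) atTop
      (𝓝 (indicatorConstLp p (MeasurableSet.iUnion hs) (measure_ne_top μ _) (1 : ℝ))) := by
    refine tendsto_indicatorConstLp_set hp ?_
    have h1 : Tendsto (fun t : Finset ℕ => ∑ i ∈ t, μ (s i)) atTop (𝓝 (μ (⋃ i, s i))) := by
      rw [measure_iUnion hd hs]
      exact ENNReal.summable.hasSum
    have h2 := ENNReal.Tendsto.sub (tendsto_const_nhds (x := μ (⋃ i, s i))) h1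
      (Or.inl (measure_ne_top _ _))
    rw [tsub_self] at h2
    refine h2.congr fun t => ?_
    have hsub : (⋃ i ∈ t, s i) ⊆ ⋃ i, s i := Set.iUnion₂_subset fun i _ => Set.subset_iUnion s i
    rw [Set.symmDiff_def, Set.sdiff_eq_empty.2 hsub, Set.empty_union,
      measure_sdiff hsub (t.measurableSet_biUnion fun i _ => hs i).nullMeasurableSet
        (measure_ne_top _ _), measure_biUnion_finset (fun i _ j _ hij => hd hij) fun i _ => hs i]
  simpa only [HasSum, SummationFilter.unconditional_filter, indicatorConstLp_finset_biUnion hs hd] using this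

open Classical in
/-- The signed measure `s ↦ ℓ (1_s)` of a continuous functional `ℓ` on `Lᵖ`. -/
def signedMeasureOfDual (hp : p ≠ ∞) (ℓ : Lp ℝ p μ →L[ℝ] ℝ) : SignedMeasure α where
  measureOf' s := if hs : MeasurableSet s then
    ℓ (indicatorConstLp p hs (measure_ne_top μ _) 1) else 0
  empty' := by simp
  not_measurable' s hs := by simp [hs]
  m_iUnion' s hs hd := by
    simp only [hs, MeasurableSet.iUnion hs, dif_pos]
    exact ℓ.hasSum (hasSum_indicatorConstLp hp hs hd)

theorem signedMeasureOfDual_apply (hp : p ≠ ∞) (ℓ : Lp ℝ p μ →L[ℝ] ℝ) {s : Set α}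
    (hs : MeasurableSet s) :
    signedMeasureOfDual hp ℓ s = ℓ (indicatorConstLp p hs (measure_ne_top μ _) 1) :=
  dif_pos hs

/-- Radon–Nikodym for the signed measure `s ↦ ℓ (1_s)`, which is absolutely continuous because the
indicator of a null set vanishes in `Lᵖ`. -/
theorem exists_integrable_apply_indicator_eq (hp : p ≠ ∞) (ℓ : Lp ℝ p μ →L[ℝ] ℝ) :
    ∃ g : α → ℝ, Integrable g μ ∧ ∀ (s : Set α) (hs : MeasurableSet s),
      ℓ (indicatorConstLp p hs (measure_ne_top μ _) 1) = ∫ x in s, g x ∂μ := by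
  refine ⟨(signedMeasureOfDual hp ℓ).rnDeriv μ, SignedMeasure.integrable_rnDeriv _ _,
    fun s hs => ?_⟩
  have hac : signedMeasureOfDual hp ℓ ≪ᵥ μ.toENNRealVectorMeasure := by
    refine VectorMeasure.AbsolutelyContinuous.mk fun s hs h0 => ?_
    rw [Measure.toENNRealVectorMeasure_apply_measurable hs] at h0
    rw [signedMeasureOfDual_apply hp ℓ hs]
    convert map_zero ℓ
    rw [← norm_eq_zero, norm_indicatorConstLp (zero_lt_one.trans_le Fact.out).ne' hp]
    have hp0 : p.toReal ≠ 0 := (ENNReal.toReal_pos (zero_lt_one.trans_le Fact.out).ne' hp).ne'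
    simp [measureReal_def, h0, hp0]
  have h := congrArg (fun ν : SignedMeasure α => ν s)
    (SignedMeasure.withDensityᵥ_rnDeriv_eq _ μ hac)
  simp only [withDensityᵥ_apply (SignedMeasure.integrable_rnDeriv _ _) hs,
    signedMeasureOfDual_apply hp ℓ hs] at h
  exact h.symm

/-- A continuous functional on `Lᵖ` of a finite measure, `p < ∞`, is represented on bounded
functions by an integrable function. -/
theorem exists_integrable_apply_bounded_eq (hp : p ≠ ∞) (ℓ : Lp ℝ p μ →L[ℝ] ℝ) :
    ∃ g : α → ℝ, Integrable g μ ∧ ∀ (f : α → ℝ) (hf : MemLp f p μ), Measurable f →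
      (∃ C, ∀ x, ‖f x‖ ≤ C) → ℓ (hf.toLp f) = ∫ x, f x * g x ∂μ := by
  obtain ⟨g, hg, hgs⟩ := exists_integrable_apply_indicator_eq hp ℓ
  have hsimple (f : SimpleFunc α ℝ) (hf : MemLp f p μ) :
      ℓ (hf.toLp f) = ∫ x, f x * g x ∂μ := by
    induction f using SimpleFunc.induction with
    | const c hs =>
      rename_i s
      have h1 : hf.toLp _ = c • indicatorConstLp p hs (measure_ne_top μ _) (1 : ℝ) := by
        rw [indicatorConstLp, ← MemLp.toLp_const_smul]
        refine MemLp.toLp_congr _ _ (Eventually.of_forall fun x => ?_)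
        by_cases hx : x ∈ s <;> simp [hx]
      rw [h1, map_smul, hgs, ← integral_indicator hs, smul_eq_mul, ← integral_const_mul]
      refine integral_congr_ae (Eventually.of_forall fun x => ?_)
      by_cases hx : x ∈ s <;> simp [hx]
    | add hdis h1 h2 =>
      rename_i f₁ f₂
      have m1 : MemLp f₁ p μ := f₁.memLp_of_isFiniteMeasure _ _
      have m2 : MemLp f₂ p μ := f₂.memLp_of_isFiniteMeasure _ _
      obtain ⟨C₁, hC₁⟩ := f₁.exists_forall_norm_le
      obtain ⟨C₂, hC₂⟩ := f₂.exists_forall_norm_le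
      have e : hf.toLp _ = m1.toLp f₁ + m2.toLp f₂ := MemLp.toLp_add m1 m2
      rw [e, map_add, h1 m1, h2 m2, ← integral_add]
      · simp [add_mul]
      · exact hg.bdd_mul f₁.aestronglyMeasurable (Eventually.of_forall hC₁)
      · exact hg.bdd_mul f₂.aestronglyMeasurable (Eventually.of_forall hC₂)
  refine ⟨g, hg, fun f hf hfm ⟨C, hC⟩ => ?_⟩
  -- The approximants converge both in `Lᵖ` and pointwise, with `|F n| ≤ |f| + |f| ≤ C + C`.
  -- Boundedness of `f` supplies the domination, as `g` is only known to be integrable.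
  let F (n : ℕ) := SimpleFunc.approxOn f hfm (Set.range f ∪ {0}) 0 (by simp) n
  have t1 := (ℓ.continuous.tendsto _).comp (SimpleFunc.tendsto_approxOn_range_Lp hp hfm hf)
  have t2 : Tendsto (fun n => ∫ x, F n x * g x ∂μ) atTop (𝓝 (∫ x, f x * g x ∂μ)) := by
    refine tendsto_integral_of_dominated_convergence (fun x => (C + C) * ‖g x‖)
      (fun n => (F n).aestronglyMeasurable.mul hg.1) (hg.norm.const_mul _)
      (fun n => Eventually.of_forall fun x => ?_) (Eventually.of_forall fun x => ?_)
    · rw [norm_mul]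
      gcongr
      exact (SimpleFunc.norm_approxOn_zero_le hfm _ x n).trans (add_le_add (hC x) (hC x))
    · exact (SimpleFunc.tendsto_approxOn hfm _ (subset_closure (by simp))).mul_const _
  exact tendsto_nhds_unique t1 (t2.congr fun n => (hsimple (F n) _).symm)

end LpDual

/-! ### The cube and the pairing of `L^d` with `BV` -/

theorem isCompact_cube (d : ℕ) : IsCompact (cube d) := by
  have h : cube d = (EuclideanSpace.equiv (Fin d) ℝ) ⁻¹' Set.univ.pi fun _ => Set.Icc 0 1 := by
    ext x
    exact ⟨fun h i _ => h i, fun h i => h i trivial⟩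
  rw [h]
  exact (EuclideanSpace.equiv (Fin d) ℝ).toHomeomorph.isCompact_preimage.2
    (isCompact_univ_pi fun _ => isCompact_Icc)

theorem measurableSet_cube (d : ℕ) : MeasurableSet (cube d) :=
  (isCompact_cube d).isClosed.measurableSet

instance isFiniteMeasure_restrict_cube (d : ℕ) :
    IsFiniteMeasure ((volume : Measure (E d)).restrict (cube d)) :=
  isFiniteMeasure_restrict.2 (isCompact_cube d).measure_ne_top

namespace BV

theorem ae_eq_zero (u : BV d) : ∀ᵐ x, x ∉ cube d → u x = 0 := u.2.1

theorem integrable (u : BV d) : Integrable (u : E d → ℝ) := L1.integrable_coeFn _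

theorem indicator_ae_eq (u : BV d) : (cube d).indicator (u : E d → ℝ) =ᵐ[volume] u := by
  filter_upwards [u.ae_eq_zero] with x hx
  by_cases h : x ∈ cube d
  · simp [h]
  · simp [h, hx h]

theorem setIntegral_mul (u : BV d) (f : E d → ℝ) :
    ∫ x in cube d, f x * u x = ∫ x, u x * f x := by
  rw [← integral_indicator (measurableSet_cube d)]
  refine integral_congr_ae ?_
  filter_upwards [u.ae_eq_zero] with x hx
  by_cases h : x ∈ cube d
  · simp [h, mul_comm]
  · simp [h, hx h]

theorem toReal_variation_le_norm (u : BV d) : (variation (u : E d → ℝ)).toReal ≤ ‖u‖ := by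
  rw [norm_def]
  exact le_add_of_nonneg_left (norm_nonneg _)

theorem norm_toL1_le (u : BV d) : ‖toL1 u‖ ≤ ‖u‖ := by
  rw [norm_def]
  exact le_add_of_nonneg_right ENNReal.toReal_nonneg

theorem norm_toL1 (u : BV d) : ‖toL1 u‖ = ∫ x, ‖u x‖ := L1.norm_eq_integral_norm _

/-- The element of `BV` given by an integrable function on the cube, provided its extension by
zero has finite variation. -/
theorem exists_ae_eq_indicator {g : E d → ℝ} (hg : IntegrableOn g (cube d))
    (hv : variation ((cube d).indicator g) < ∞) :
    ∃ u : BV d, (u : E d → ℝ) =ᵐ[volume] (cube d).indicator g := by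
  have hi : Integrable ((cube d).indicator g) :=
    (integrable_indicator_iff (measurableSet_cube d)).2 hg
  have h := hi.coeFn_toL1
  refine ⟨⟨hi.toL1 _, ?_, ?_⟩, h⟩
  · filter_upwards [h] with x hx hxc
    rw [hx, Set.indicator_of_notMem hxc]
  · rwa [variation_congr h]

end BV

theorem exists_pairing_bound (hd : 1 ≤ d) :
    ∃ C : ℝ≥0, ∀ (f : Ld d) (u : BV d), IntegrableOn (fun x => f x * u x) (cube d) ∧
      |∫ x in cube d, f x * u x| ≤ C * ‖f‖ * ‖u‖ := by
  obtain ⟨p, C, hp, h⟩ := exists_eLpNorm_le_variation hd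
  refine ⟨C, fun f u => ?_⟩
  have hu : eLpNorm (u : E d → ℝ) p (volume.restrict (cube d)) ≤ C * variation (u : E d → ℝ) := by
    refine (eLpNorm_mono_measure _ Measure.restrict_le_self).trans ?_
    -- A representative of `u` vanishes only almost everywhere off the cube; its truncation has
    -- genuinely compact support, as the Sobolev inequality demands.
    rw [← eLpNorm_congr_ae u.indicator_ae_eq, ← variation_congr u.indicator_ae_eq]
    refine h _ (u.integrable.indicator (measurableSet_cube d)) ?_
    exact HasCompactSupport.of_support_subset_isCompact (isCompact_cube d)
      Set.support_indicator_subset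
  have hm := u.integrable.1.restrict (s := cube d)
  have hup : MemLp (u : E d → ℝ) p (volume.restrict (cube d)) :=
    ⟨hm, hu.trans_lt (ENNReal.mul_lt_top ENNReal.coe_lt_top u.variation_lt_top)⟩
  have hint : IntegrableOn (fun x => f x * u x) (cube d) :=
    memLp_one_iff_integrable.1 (hup.smul (Lp.memLp f))
  refine ⟨hint, ?_⟩
  have h1 : eLpNorm (fun x => f x * u x) 1 (volume.restrict (cube d)) ≤
      eLpNorm f d (volume.restrict (cube d)) * (C * variation (u : E d → ℝ)) :=
    (eLpNorm_smul_le_mul_eLpNorm (r := 1) hm (Lp.memLp f).1).trans (by gcongr)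
  have h2 := ENNReal.toReal_mono (ENNReal.mul_ne_top (Lp.memLp f).2.ne
    (ENNReal.mul_ne_top ENNReal.coe_ne_top u.variation_lt_top.ne)) h1
  rw [eLpNorm_one_eq_lintegral_enorm, ← integral_norm_eq_lintegral_enorm hint.1,
    ENNReal.toReal_mul, ENNReal.toReal_mul, ENNReal.coe_toReal, ← Lp.norm_def] at h2
  calc |∫ x in cube d, f x * u x| ≤ ∫ x in cube d, ‖f x * u x‖ :=
        norm_integral_le_integral_norm (fun x => f x * u x)
    _ ≤ ‖f‖ * (C * (variation (u : E d → ℝ)).toReal) := h2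
    _ ≤ ‖f‖ * (C * ‖u‖) := by
        gcongr
        exacts [ENNReal.toReal_nonneg, u.toReal_variation_le_norm]
    _ = C * ‖f‖ * ‖u‖ := by ring

theorem memLp_cube_of_bounded {f : E d → ℝ} (hf : Measurable f) {C : ℝ} (hC : ∀ x, ‖f x‖ ≤ C) :
    MemLp f d (volume.restrict (cube d)) :=
  MemLp.of_bound hf.aestronglyMeasurable C (Eventually.of_forall hC)

theorem IsTestField.memLp_divergence {v : E d → E d} (hv : IsTestField v) :
    MemLp (divergence v) d (volume.restrict (cube d)) :=
  memLp_cube_of_bounded (continuous_divergence hv.contDiff).measurable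
    hv.exists_norm_divergence_le.choose_spec

theorem measurable_sign_comp {f : E d → ℝ} (hf : Measurable f) :
    Measurable fun x => (SignType.sign (f x) : ℝ) := by
  have : Measurable fun t : ℝ => (SignType.sign t : ℝ) := by
    have e : (fun t : ℝ => (SignType.sign t : ℝ)) =
        fun t => if 0 < t then 1 else if t < 0 then -1 else 0 := by
      ext t
      rcases lt_trichotomy t 0 with h | h | h <;> simp [h, not_lt.2 h.le, sign_apply]
    rw [e]
    exact Measurable.ite measurableSet_Ioi measurable_const
      (Measurable.ite measurableSet_Iio measurable_const measurable_const)
  exact this.comp hf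

/-- The canonical map `Υ`. -/
def canonicalMap (d : ℕ) : BV d →L[ℝ] StrongDual ℝ (SCH d) := (SCH d).subtypeL.flip

theorem canonicalMap_apply (u : BV d) (α : SCH d) :
    canonicalMap d u α = (α : StrongDual ℝ (BV d)) u := rfl

theorem variation_le_of_forall_integral_le {u : E d → ℝ} {C : ℝ}
    (h : ∀ v, IsTestField v → ∫ x, u x * divergence v x ≤ C) :
    variation u ≤ ENNReal.ofReal C :=
  iSup₂_le fun v hv => ENNReal.ofReal_le_ofReal (h v hv)

/-! ### The functionals `T_f` and the canonical isomorphism -/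

variable [Fact (1 ≤ (d : ℝ≥0∞))]

theorem one_le_of_fact : 1 ≤ d := by
  exact_mod_cast (Fact.out : 1 ≤ (d : ℝ≥0∞))

theorem integrableOn_mul (f : Ld d) (u : BV d) : IntegrableOn (fun x => f x * u x) (cube d) :=
  ((exists_pairing_bound one_le_of_fact).choose_spec f u).1

/-- The map `f ↦ T_f` as a continuous linear map. -/
def functional (d : ℕ) [Fact (1 ≤ (d : ℝ≥0∞))] : Ld d →L[ℝ] StrongDual ℝ (BV d) :=
  LinearMap.mkContinuous₂
    (LinearMap.mk₂ ℝ (fun (f : Ld d) (u : BV d) => ∫ x in cube d, f x * u x)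
      (fun f g u => by
        rw [← integral_add (integrableOn_mul f u) (integrableOn_mul g u)]
        refine integral_congr_ae ?_
        filter_upwards [Lp.coeFn_add f g] with x hx
        rw [hx, Pi.add_apply, add_mul])
      (fun c f u => by
        rw [smul_eq_mul, ← integral_const_mul]
        refine integral_congr_ae ?_
        filter_upwards [Lp.coeFn_smul c f] with x hx
        rw [hx, Pi.smul_apply, smul_eq_mul, mul_assoc])
      (fun f u w => by
        rw [← integral_add (integrableOn_mul f u) (integrableOn_mul f w)]
        refine integral_congr_ae (ae_restrict_of_ae ?_)
        filter_upwards [Lp.coeFn_add (BV.toL1 u) (BV.toL1 w)] with x hx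
        rw [map_add, hx, Pi.add_apply, mul_add])
      (fun c f u => by
        rw [smul_eq_mul, ← integral_const_mul]
        refine integral_congr_ae (ae_restrict_of_ae ?_)
        filter_upwards [Lp.coeFn_smul c (BV.toL1 u)] with x hx
        rw [map_smul, hx, Pi.smul_apply, smul_eq_mul, mul_left_comm]))
    (exists_pairing_bound one_le_of_fact).choose
    fun f u => ((exists_pairing_bound one_le_of_fact).choose_spec f u).2

theorem represents_functional (f : Ld d) : Represents f (functional d f) :=
  fun u => ⟨integrableOn_mul f u, rfl⟩

theorem Represents.eq_functional {f : Ld d} {α : StrongDual ℝ (BV d)} (h : Represents f α) :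
    α = functional d f :=
  ContinuousLinearMap.ext fun u => (h u).2

theorem functional_mem_SCH (f : Ld d) : functional d f ∈ SCH d :=
  (rangeT d).le_topologicalClosure ⟨f, represents_functional f⟩

/-- `f ↦ T_f` with values in `SCH`. -/
def toSCH (d : ℕ) [Fact (1 ≤ (d : ℝ≥0∞))] : Ld d →L[ℝ] SCH d :=
  (functional d).codRestrict (SCH d) functional_mem_SCH

theorem denseRange_toSCH : DenseRange (toSCH d) := by
  intro α
  rw [closure_subtype]
  refine closure_mono ?_ α.2
  rintro _ ⟨f, hf⟩
  exact ⟨_, ⟨f, rfl⟩, hf.eq_functional.symm⟩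

theorem toSCH_toLp_apply {f : E d → ℝ} (hf : MemLp f d (volume.restrict (cube d))) (u : BV d) :
    (toSCH d (hf.toLp f) : StrongDual ℝ (BV d)) u = ∫ x, u x * f x := by
  rw [← u.setIntegral_mul]
  change ∫ x in cube d, hf.toLp f x * u x = _
  refine integral_congr_ae ?_
  filter_upwards [hf.coeFn_toLp] with x hx
  rw [hx]

/-- The pairing with `u` is one of the integrals whose supremum is the variation, and `-v` handles
the other sign. The bound does not involve the `L^d` norm of `div v`; both injectivity and
surjectivity of `Υ` rest on this. -/
theorem IsTestField.norm_toSCH_divergence_le {v : E d → E d} (hv : IsTestField v) :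
    ‖toSCH d (hv.memLp_divergence.toLp _)‖ ≤ 1 := by
  refine ContinuousLinearMap.opNorm_le_bound _ zero_le_one fun u => ?_
  change ‖(toSCH d (hv.memLp_divergence.toLp _) : StrongDual ℝ (BV d)) u‖ ≤ 1 * ‖u‖
  rw [toSCH_toLp_apply, one_mul, Real.norm_eq_abs, abs_le']
  have h (v : E d → E d) (hv : IsTestField v) : ∫ x, u x * divergence v x ≤ ‖u‖ :=
    (integral_le_toReal_variation hv u.variation_lt_top.ne).trans u.toReal_variation_le_norm
  refine ⟨h v hv, ?_⟩
  simpa [divergence_neg, integral_neg] using h (-v) hv.neg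

theorem norm_toSCH_le_one_of_bounded {f : E d → ℝ} (hf : MemLp f d (volume.restrict (cube d)))
    (hf1 : ∀ x, ‖f x‖ ≤ 1) : ‖toSCH d (hf.toLp f)‖ ≤ 1 := by
  refine ContinuousLinearMap.opNorm_le_bound _ zero_le_one fun u => ?_
  change ‖(toSCH d (hf.toLp _) : StrongDual ℝ (BV d)) u‖ ≤ 1 * ‖u‖
  rw [toSCH_toLp_apply, one_mul]
  refine le_trans ?_ u.norm_toL1_le
  rw [u.norm_toL1]
  refine norm_integral_le_of_norm_le u.integrable.norm (Eventually.of_forall fun x => ?_)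
  rw [norm_mul]
  exact mul_le_of_le_one_right (norm_nonneg _) (hf1 x)

/-- The constant `2` counts the two summands of the norm, each of which is at most `‖Υ u‖`. -/
theorem norm_le_two_mul_norm_canonicalMap (u : BV d) : ‖u‖ ≤ 2 * ‖canonicalMap d u‖ := by
  have h1 : (variation (u : E d → ℝ)).toReal ≤ ‖canonicalMap d u‖ := by
    refine ENNReal.toReal_le_of_le_ofReal (norm_nonneg _)
      (variation_le_of_forall_integral_le fun v hv => ?_)
    rw [← toSCH_toLp_apply hv.memLp_divergence, ← canonicalMap_apply]
    exact (le_abs_self _).trans ((canonicalMap d u).unit_le_opNorm _ hv.norm_toSCH_divergence_le)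
  have h2 : ‖BV.toL1 u‖ ≤ ‖canonicalMap d u‖ := by
    have hm : Measurable (u : E d → ℝ) := (Lp.stronglyMeasurable _).measurable
    have hb (x : E d) : ‖(SignType.sign (u x) : ℝ)‖ ≤ 1 := by
      rcases h : SignType.sign (u x) <;> simp
    have hf := memLp_cube_of_bounded (measurable_sign_comp hm) hb
    have e : ‖BV.toL1 u‖ = canonicalMap d u (toSCH d (hf.toLp _)) := by
      rw [canonicalMap_apply, toSCH_toLp_apply, u.norm_toL1]
      exact integral_congr_ae (Eventually.of_forall fun x => (self_mul_sign (u x)).symm)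
    rw [e]
    exact (le_abs_self _).trans
      ((canonicalMap d u).unit_le_opNorm _ (norm_toSCH_le_one_of_bounded hf hb))
  rw [BV.norm_def]
  linarith

theorem surjective_canonicalMap : Function.Surjective (canonicalMap d) := by
  intro L
  have hd : (d : ℝ≥0∞) ≠ ∞ := ENNReal.natCast_ne_top d
  obtain ⟨g, hg, h⟩ := exists_integrable_apply_bounded_eq hd (L ∘L toSCH d)
  have hind (f : E d → ℝ) : ∫ x, (cube d).indicator g x * f x = ∫ x in cube d, f x * g x := by
    rw [← integral_indicator (measurableSet_cube d)]
    refine integral_congr_ae (Eventually.of_forall fun x => ?_)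
    by_cases hx : x ∈ cube d <;> simp [hx, mul_comm]
  -- The divergence of a test field is bounded on the cube, so `g` represents `L ∘ T` on it, and
  -- `‖T_{div v}‖ ≤ 1` bounds the result by `‖L‖`.
  have hvar : variation ((cube d).indicator g) < ∞ := by
    refine (variation_le_of_forall_integral_le (C := ‖L‖) fun v hv => ?_).trans_lt
      ENNReal.ofReal_lt_top
    rw [hind, ← h _ hv.memLp_divergence (continuous_divergence hv.contDiff).measurable
      hv.exists_norm_divergence_le]
    exact (le_abs_self _).trans (L.unit_le_opNorm _ hv.norm_toSCH_divergence_le)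
  obtain ⟨u, hu⟩ := BV.exists_ae_eq_indicator hg hvar
  refine ⟨u, ?_⟩
  -- The representation by `g` is available on bounded functions only; simple functions suffice,
  -- being dense in `L^d` as `d < ∞`.
  have hT : canonicalMap d u ∘L toSCH d = L ∘L toSCH d := by
    refine ContinuousLinearMap.coeFn_injective ((Lp.simpleFunc.denseRange hd).equalizer
      (ContinuousLinearMap.continuous _) (ContinuousLinearMap.continuous _) (funext fun f => ?_))
    let F := Lp.simpleFunc.toSimpleFunc f
    have hF : MemLp F d (volume.restrict (cube d)) := Lp.simpleFunc.memLp f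
    have e : (f : Ld d) = hF.toLp F := by
      conv_lhs => rw [← Lp.simpleFunc.toLp_toSimpleFunc f]
    simp only [Function.comp_apply, e]
    rw [h F hF F.measurable F.exists_forall_norm_le, ← hind]
    refine (toSCH_toLp_apply hF u).trans (integral_congr_ae ?_)
    filter_upwards [hu] with x hx
    rw [hx]
  refine ContinuousLinearMap.coeFn_injective (denseRange_toSCH.equalizer
    (ContinuousLinearMap.continuous _) (ContinuousLinearMap.continuous _) ?_)
  exact congrArg DFunLike.coe hT

theorem completeSpace_SCH (d : ℕ) : CompleteSpace (SCH d) :=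
  (rangeT d).isClosed_topologicalClosure.completeSpace_coe

/-- The canonical isomorphism `BV ≃ SCH*`. -/
theorem exists_canonicalEquiv : ∃ Υ : BV d ≃L[ℝ] StrongDual ℝ (SCH d),
    ∀ u α, Υ u α = (α : StrongDual ℝ (BV d)) u := by
  have hanti : AntilipschitzWith 2 (canonicalMap d) :=
    AddMonoidHomClass.antilipschitz_of_bound _ norm_le_two_mul_norm_canonicalMap
  let e : BV d ≃ₗ[ℝ] StrongDual ℝ (SCH d) :=
    LinearEquiv.ofBijective (canonicalMap d).toLinearMap ⟨hanti.injective, surjective_canonicalMap⟩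
  refine ⟨e.toContinuousLinearEquivOfBounds ‖canonicalMap d‖ 2 (canonicalMap d).le_opNorm
    fun L => ?_, fun _ _ => rfl⟩
  have := norm_le_two_mul_norm_canonicalMap (e.symm L)
  rwa [show canonicalMap d (e.symm L) = L from e.apply_symm_apply L] at this

end StrongCharge

end

theorem mainTheorem5 (d : ℕ) (hd : 1 ≤ d) :
    -- every `T_f` is a continuous functional, with norm controlled by that of `f` in `L^d`
    (∃ C : ℝ, ∀ f : StrongCharge.Ld d, ∃ α : StrongDual ℝ (StrongCharge.BV d),
      StrongCharge.Represents f α ∧ ‖α‖ ≤ C * ‖f‖) ∧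
    -- both spaces are Banach spaces and the canonical map is an isomorphism
    CompleteSpace (StrongCharge.BV d) ∧
    CompleteSpace (StrongCharge.SCH d) ∧
    ∃ Υ : StrongCharge.BV d ≃L[ℝ] StrongDual ℝ (StrongCharge.SCH d),
      ∀ (u : StrongCharge.BV d) (α : StrongCharge.SCH d),
        Υ u α = (α : StrongDual ℝ (StrongCharge.BV d)) u := by
  have : Fact (1 ≤ (d : ENNReal)) := ⟨by exact_mod_cast hd⟩
  obtain ⟨Υ, hΥ⟩ := StrongCharge.exists_canonicalEquiv (d := d)
  refine ⟨⟨‖StrongCharge.functional d‖, fun f => ⟨StrongCharge.functional d f,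
    StrongCharge.represents_functional f, (StrongCharge.functional d).le_opNorm f⟩⟩,
    ?_, StrongCharge.completeSpace_SCH d, Υ, hΥ⟩
  -- A dual space is always complete, and `Υ` is a uniform isomorphism.
  exact (completeSpace_congr (e := Υ.toEquiv) Υ.isUniformEmbedding).2 inferInstance
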